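/- All graphs are finite and simple. A connected graph $G$ is equiarboreal if the number of spanning trees of $G$ containing a given edge does not depend on the edge. An edge cut of $G$ is a set of edges of the form $C=\{uv\in E(G) : u\in A,\ v\in B\}$, where $(A,B)$ is a partition of $V(G)$ into two non-empty sets; it is non-trivial if $|A|\ge 2$ and $|B|\ge 2$. $G[C]$ denotes the subgraph of $G$ whose edge set is $C$ and whose vertices are the ends of the edges in $C$. Let $S_x$ be the star with $x$ vertices. For an integer $x\ge 3$, $G[C]$ is called strongly $S_x$-free if there is no vertex $u$ of $G[C]$ such that the subgraph of $G[C]$ induced by the closed neighbourhood $N_{G[C]}[u]$ is a star $S_x$ and at least one leaf of this star has degree $1$ in $G[C]$. Theorem. Let $G$ be a connected $k$-regular equiarboreal graph and let $C$ be an edge cut of $G$. (i) If $k\ge 6$ and $|C|\le k-1$, then $G[C]$ is strongly $S_x$-free for every integer $x\ge 3$. (ii) If $k\ge 8$, $C$ is non-trivial and $|C|\le k$, then $G[C]$ is strongly $S_x$-free for every integer $x\ge 3$. -/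

import Mathlib

namespace SimpleGraph

variable {V : Type*}

/-- `G` is equiarboreal: the number of spanning trees of `G` containing a given edge does not
depend on the edge. A spanning tree is a tree on the whole vertex set that is contained in `G`. -/
def IsEquiarboreal (G : SimpleGraph V) : Prop :=
  ∀ e ∈ G.edgeSet, ∀ f ∈ G.edgeSet,
    {T : SimpleGraph V | T ≤ G ∧ T.IsTree ∧ e ∈ T.edgeSet}.ncard =
      {T : SimpleGraph V | T ≤ G ∧ T.IsTree ∧ f ∈ T.edgeSet}.ncard

/-- The set of edges of `G` with one end in `A` and the other end in the complement of `A`. -/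
def edgesAcross (G : SimpleGraph V) (A : Set V) : Set (Sym2 V) :=
  {e | ∃ u ∈ A, ∃ v ∈ Aᶜ, G.Adj u v ∧ e = s(u, v)}

/-- `C` is an edge cut of `G`: the set of edges across a partition `(A, Aᶜ)` of the vertex set
into two non-empty parts. -/
def IsEdgeCut (G : SimpleGraph V) (C : Set (Sym2 V)) : Prop :=
  ∃ A : Set V, A.Nonempty ∧ Aᶜ.Nonempty ∧ C = G.edgesAcross A

/-- `C` is a non-trivial edge cut of `G`: both parts have at least two vertices. -/
def IsNontrivialEdgeCut (G : SimpleGraph V) (C : Set (Sym2 V)) : Prop :=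
  ∃ A : Set V, A.Nontrivial ∧ Aᶜ.Nontrivial ∧ C = G.edgesAcross A

/-- The edge-induced subgraph `G[C]`: its edges are the edges of `G` in `C`, its vertices are the
ends of these edges. -/
def edgeInduced (G : SimpleGraph V) (C : Set (Sym2 V)) : G.Subgraph where
  verts := {u | ∃ v, G.Adj u v ∧ s(u, v) ∈ C}
  Adj u v := G.Adj u v ∧ s(u, v) ∈ C
  adj_sub h := h.1
  edge_vert {_ v} h := ⟨v, h⟩
  symm := ⟨fun u v h => ⟨h.1.symm, Sym2.eq_swap (a := u) (b := v) ▸ h.2⟩⟩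

/-- The star `S_x` of order `x`, with centre `0`. -/
def starOfOrder (x : ℕ) : SimpleGraph (Fin x) :=
  fromRel fun i _ => i.val = 0

/-- The closed neighbourhood of `u` in a subgraph `H`. -/
def Subgraph.closedNbhd {G : SimpleGraph V} (H : G.Subgraph) (u : V) : Set V :=
  insert u (H.neighborSet u)

/-- `H` is strongly `S_x`-free: no vertex `u` of `H` is such that the subgraph of `H` induced by
its closed neighbourhood is a star `S_x` at least one of whose leaves has degree `1` in `H`.
The isomorphism `φ` identifies `S_x` with the induced subgraph; the leaves of `S_x` are its vertices
of degree `1` (the notion is used for `x ≥ 3`). -/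
def Subgraph.IsStronglyStarFree {G : SimpleGraph V} (H : G.Subgraph) (x : ℕ) : Prop :=
  ¬ ∃ u ∈ H.verts, ∃ φ : starOfOrder x ≃g (H.induce (H.closedNbhd u)).coe,
    ∃ i : Fin x, ((starOfOrder x).neighborSet i).ncard = 1 ∧
      (H.neighborSet (φ i : V)).ncard = 1

end SimpleGraph

/-!
The proof shows more than strong star-freeness: no vertex has degree one in `G[C]`, so there is no
star with a leaf of degree one at all.

Write `E f` for the Dirichlet energy of `f : V → ℝ`, the sum of `(f x - f y) ^ 2` over the edges
`xy`. By Kirchhoff, the effective resistance between the ends of an edge `uv` is the proportion of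
spanning trees through `uv`; so `E f` is at least the inverse of this proportion whenever
`f u - f v = 1` (`SimpleGraph.card_spanningTrees_le_dirichlet`). The potential behind this is the
number of spanning trees `T` through `uv` that have `x` on the side of `u` in `T - uv`. That it is
harmonic away from `u` and `v` comes from exchanging `uv` for an edge `ab` that reconnects `T - uv`,
a bijection onto the trees for which `uv` and `ab` have changed roles
(`SimpleGraph.card_spanningTrees_exchange`). In an equiarboreal `k`-regular graph on `n` vertices
all edges have the same proportion `2 * (n - 1) / (n * k)`, so every such `f` has `E f > k / 2`
(`SimpleGraph.IsEquiarboreal.half_lt_dirichlet`).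

Now let `uv` be an edge of the cut `(A, Aᶜ)` with `u ∈ A`, let `v` have degree one in the cut, and
let `a` be the number of neighbours of `u` in `A`. For combinations of the indicators of `A` and of
two adjacent vertices the energy depends only on `k`, the size of the cut and the degrees in the
cut, and one of three choices has `E f ≤ k / 2`, a contradiction
(`SimpleGraph.IsEquiarboreal.cutDegree_ne_one`):
* if `a ≥ 4`, a function with the values `1`, `3 / 4`, `1 / 2`, `0` on `u`, the rest of `A`, the
  rest of `Aᶜ`, and `v`;
* if `a = 3`, a function with the values `1`, `2 / 3`, `1 / 3`, `0` on `w`, `A \ {u, w}`, `Aᶜ`,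
  and `u`, where `w` is a neighbour of `u` in `A` with the fewest cut edges;
* if `a ≤ 2`, the indicator of `A \ {u}`, because moving `u` across makes the cut too small.
-/

namespace SimpleGraph

variable {V : Type*}

/-! ### Deleting an edge of a tree and the exchange of edges -/

/-- The side of `a` in `T - ab`: the vertices that can be reached from `a` in `T` without using the
edge `ab`. For an edge `ab` of a tree, the two sides `T.side a b` and `T.side b a` partition the
vertex set. -/
def side (T : SimpleGraph V) (a b : V) : Set V :=
  {y | (T.deleteEdges {s(a, b)}).Reachable a y}

theorem mem_side_self (T : SimpleGraph V) (a b : V) : a ∈ T.side a b :=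
  Reachable.refl _

theorem Connected.mem_side_or_mem_side {T : SimpleGraph V} (hT : T.Connected) (a b y : V) :
    y ∈ T.side a b ∨ y ∈ T.side b a := by
  have key : ∀ z, Relation.ReflTransGen T.Adj a z → z ∈ T.side a b ∨ z ∈ T.side b a := by
    intro z hz
    induction hz with
    | refl => exact Or.inl (T.mem_side_self a b)
    | @tail p q _ hpq ih =>
      by_cases he : s(p, q) = s(a, b)
      · rcases Sym2.eq_iff.1 he with ⟨-, rfl⟩ | ⟨-, rfl⟩
        · exact Or.inr (T.mem_side_self _ _)
        · exact Or.inl (T.mem_side_self _ _)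
      · have h1 : (T.deleteEdges {s(a, b)}).Adj p q := by
          rw [deleteEdges_adj]; exact ⟨hpq, he⟩
        have h2 : (T.deleteEdges {s(b, a)}).Adj p q := by
          rwa [Sym2.eq_swap]
        exact ih.imp (fun h => Reachable.trans h h1.reachable)
          (fun h => Reachable.trans h h2.reachable)
  exact key y ((reachable_iff_reflTransGen _ _).1 (hT.preconnected a y))

theorem IsTree.notMem_side {T : SimpleGraph V} (hT : T.IsTree) {a b : V} (hab : T.Adj a b) :
    b ∉ T.side a b :=
  isAcyclic_iff_forall_adj_isBridge.1 hT.isAcyclic hab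

theorem IsTree.mem_side_swap {T : SimpleGraph V} (hT : T.IsTree) {a b : V} (hab : T.Adj a b)
    (y : V) : y ∈ T.side b a ↔ y ∉ T.side a b := by
  refine ⟨fun h h' => hT.notMem_side hab ?_, fun h =>
    (hT.connected.mem_side_or_mem_side a b y).resolve_left h⟩
  have h1 : (T.deleteEdges {s(a, b)}).Reachable b y := by
    rw [Sym2.eq_swap]; exact h
  exact Reachable.trans h' h1.symm

/-- The graph obtained from `T` by replacing the edge `uv` by the edge `ab`. -/
def exchange (T : SimpleGraph V) (u v a b : V) : SimpleGraph V :=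
  T.deleteEdges {s(u, v)} ⊔ edge a b

section Exchange

variable {T : SimpleGraph V} {u v a b : V}

theorem deleteEdges_exchange (ha : a ∈ T.side u v) (hb : b ∉ T.side u v) :
    (T.exchange u v a b).deleteEdges {s(a, b)} = T.deleteEdges {s(u, v)} := by
  have hab : ¬ (T.deleteEdges {s(u, v)}).Adj a b := fun h =>
    hb (Reachable.trans ha h.reachable)
  have hba : ¬ (T.deleteEdges {s(u, v)}).Adj b a := fun h => hab h.symm
  ext x y
  rw [deleteEdges_adj, exchange, sup_adj, edge_adj]
  constructor
  · rintro ⟨h | h, h'⟩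
    · exact h
    · exact absurd (by simpa using h.1) h'
  · intro h
    refine ⟨Or.inl h, fun h' => ?_⟩
    rcases Sym2.eq_iff.1 h' with ⟨rfl, rfl⟩ | ⟨rfl, rfl⟩
    exacts [hab h, hba h]

theorem exchange_adj (ha : a ∈ T.side u v) (hb : b ∉ T.side u v) :
    (T.exchange u v a b).Adj a b := by
  rw [exchange, sup_adj, edge_adj]
  refine Or.inr ⟨Or.inl ⟨rfl, rfl⟩, ?_⟩
  rintro rfl
  exact hb ha

theorem IsTree.exchange (hT : T.IsTree) (ha : a ∈ T.side u v) (hb : b ∉ T.side u v) :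
    (T.exchange u v a b).IsTree := by
  have hle : T.deleteEdges {s(u, v)} ≤ T.exchange u v a b := le_sup_left
  have hua : (T.exchange u v a b).Reachable u a := Reachable.mono hle ha
  have hub : (T.exchange u v a b).Reachable u b := hua.trans (exchange_adj ha hb).reachable
  have hvb' : (T.deleteEdges {s(u, v)}).Reachable v b := by
    have := (hT.connected.mem_side_or_mem_side u v b).resolve_left hb
    rw [Sym2.eq_swap]; exact this
  have huv : (T.exchange u v a b).Reachable u v := hub.trans (hvb'.mono hle).symm
  have hall : ∀ y, (T.exchange u v a b).Reachable u y := by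
    intro y
    rcases hT.connected.mem_side_or_mem_side u v y with h | h
    · exact Reachable.mono hle h
    · have h' : (T.deleteEdges {s(u, v)}).Reachable v y := by
        rw [Sym2.eq_swap]; exact h
      exact huv.trans (h'.mono hle)
  have hconn : (T.exchange u v a b).Connected :=
    { preconnected := fun x y => (hall x).symm.trans (hall y), nonempty := ⟨u⟩ }
  refine ⟨hconn, ?_⟩
  refine (hT.isAcyclic.anti (deleteEdges_le _)).sup_edge_of_not_reachable fun h => hb ?_
  exact Reachable.trans ha h

theorem mem_side_exchange (ha : a ∈ T.side u v) (hb : b ∉ T.side u v) :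
    u ∈ (T.exchange u v a b).side a b := by
  change Reachable _ a u
  rw [deleteEdges_exchange ha hb]
  exact Reachable.symm ha

theorem IsTree.notMem_side_exchange (hT : T.IsTree) (huv : T.Adj u v) (ha : a ∈ T.side u v)
    (hb : b ∉ T.side u v) : v ∉ (T.exchange u v a b).side a b := by
  intro h
  change Reachable _ a v at h
  rw [deleteEdges_exchange ha hb] at h
  exact hT.notMem_side huv (Reachable.trans ha h)

theorem exchange_exchange (huv : T.Adj u v) (ha : a ∈ T.side u v) (hb : b ∉ T.side u v) :
    (T.exchange u v a b).exchange a b u v = T := by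
  rw [SimpleGraph.exchange, deleteEdges_exchange ha hb]
  ext x y
  rw [sup_adj, deleteEdges_adj, edge_adj]
  constructor
  · rintro (h | ⟨⟨rfl, rfl⟩ | ⟨rfl, rfl⟩, -⟩)
    exacts [h.1, huv, huv.symm]
  · intro h
    by_cases he : s(x, y) = s(u, v)
    · exact Or.inr ⟨by simpa using he, h.ne⟩
    · exact Or.inl ⟨h, he⟩

theorem exchange_le {G : SimpleGraph V} (hT : T ≤ G) (hab : G.Adj a b) :
    T.exchange u v a b ≤ G :=
  sup_le ((deleteEdges_le _).trans hT) ((edge_le_iff ..).2 (Or.inr hab))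

end Exchange

/-- The branches of a tree at `w` cover every other vertex exactly once. -/
theorem IsTree.existsUnique_adj_notMem_side {T : SimpleGraph V} (hT : T.IsTree) {w y : V}
    (hy : y ≠ w) : ∃! x, T.Adj w x ∧ y ∉ T.side w x := by
  obtain ⟨p, hp, -⟩ := hT.existsUnique_path w y
  cases p with
  | nil => exact absurd rfl hy
  | @cons _ x _ hwx q =>
    have hq := (Walk.cons_isPath_iff _ _).1 hp
    -- the rest of the path avoids `w`, hence every edge at `w`
    have hq' : ∀ z, (T.deleteEdges {s(w, z)}).Reachable x y := fun z =>
      ⟨q.toDeleteEdges _ fun e he h => hq.2 (by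
        rw [Set.mem_singleton_iff] at h
        subst h
        exact q.fst_mem_support_of_mem_edges he)⟩
    refine ⟨x, ⟨hwx, fun h => hT.notMem_side hwx (Reachable.trans h (hq' x).symm)⟩, ?_⟩
    rintro z ⟨hwz, hz⟩
    by_contra hne
    refine hz ?_
    have : (T.deleteEdges {s(w, z)}).Adj w x := by
      rw [deleteEdges_adj]
      refine ⟨hwx, fun h => ?_⟩
      rcases Sym2.eq_iff.1 h with ⟨-, h⟩ | ⟨h, h'⟩
      · exact hne h.symm
      · exact hwx.ne h'.symm
    exact this.reachable.trans (hq' z)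

/-! ### Spanning trees and Dirichlet energy -/

section Finite

variable [Fintype V]

open Finset

open Classical in
/-- The spanning trees of `G`. -/
noncomputable def spanningTrees (G : SimpleGraph V) : Finset (SimpleGraph V) :=
  {T | T ≤ G ∧ T.IsTree}

theorem mem_spanningTrees {G T : SimpleGraph V} : T ∈ G.spanningTrees ↔ T ≤ G ∧ T.IsTree := by
  simp [spanningTrees]

open Classical in
/-- Exchanging `uv` for `ab` is a bijection between the spanning trees in which the path from `u` to
`v` is the edge `uv` and the one from `a` to `b` runs through it in the direction from `u` to `v`,
and those with the two edges interchanged. -/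
theorem card_spanningTrees_exchange (G : SimpleGraph V) {u v a b : V} (huv : G.Adj u v)
    (hab : G.Adj a b) :
    #{T ∈ G.spanningTrees | T.Adj u v ∧ a ∈ T.side u v ∧ b ∉ T.side u v} =
      #{T ∈ G.spanningTrees | T.Adj a b ∧ u ∈ T.side a b ∧ v ∉ T.side a b} := by
  have key : ∀ {u v a b : V}, G.Adj a b →
      ∀ T ∈ ({T ∈ G.spanningTrees | T.Adj u v ∧ a ∈ T.side u v ∧ b ∉ T.side u v} : Finset _),
      T.exchange u v a b ∈
        ({T ∈ G.spanningTrees | T.Adj a b ∧ u ∈ T.side a b ∧ v ∉ T.side a b} : Finset _) := by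
    intro u v a b hab T hT
    obtain ⟨hT, h, ha, hb⟩ := Finset.mem_filter.1 hT
    obtain ⟨hle, hT⟩ := mem_spanningTrees.1 hT
    exact Finset.mem_filter.2 ⟨mem_spanningTrees.2 ⟨exchange_le hle hab, hT.exchange ha hb⟩,
      exchange_adj ha hb, mem_side_exchange ha hb, hT.notMem_side_exchange h ha hb⟩
  refine Finset.card_nbij' (fun T => T.exchange u v a b) (fun T => T.exchange a b u v)
    (key hab) (key huv) ?_ ?_
  · intro T hT
    obtain ⟨-, h, ha, hb⟩ := Finset.mem_filter.1 hT
    exact exchange_exchange h ha hb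
  · intro T hT
    obtain ⟨-, h, ha, hb⟩ := Finset.mem_filter.1 hT
    exact exchange_exchange h ha hb

open Classical in
/-- The potential of the edge `uv` at `x`: the number of spanning trees through `uv` that keep `x`
on the side of `u` when `uv` is deleted. -/
noncomputable def treePotential (G : SimpleGraph V) (u v x : V) : ℝ :=
  ∑ T ∈ G.spanningTrees, if T.Adj u v ∧ x ∈ T.side u v then 1 else 0

open Classical in
theorem treePotential_sub (G : SimpleGraph V) {u v a b : V} (huv : G.Adj u v) (hab : G.Adj a b) :
    G.treePotential u v a - G.treePotential u v b =
      ∑ T ∈ G.spanningTrees, ((if T.Adj a b ∧ v ∉ T.side a b then (1 : ℝ) else 0) -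
        if T.Adj a b ∧ u ∉ T.side a b then 1 else 0) := by
  have h1 := congrArg (Nat.cast (R := ℝ)) (G.card_spanningTrees_exchange huv hab)
  have h2 := congrArg (Nat.cast (R := ℝ)) (G.card_spanningTrees_exchange huv hab.symm)
  rw [Finset.natCast_card_filter, Finset.natCast_card_filter] at h1 h2
  have h3 : G.treePotential u v a - G.treePotential u v b =
      (∑ T ∈ G.spanningTrees,
        if T.Adj u v ∧ a ∈ T.side u v ∧ b ∉ T.side u v then (1 : ℝ) else 0) -
      ∑ T ∈ G.spanningTrees,
        if T.Adj u v ∧ b ∈ T.side u v ∧ a ∉ T.side u v then (1 : ℝ) else 0 := by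
    rw [treePotential, treePotential, ← Finset.sum_sub_distrib, ← Finset.sum_sub_distrib]
    refine Finset.sum_congr rfl fun T _ => ?_
    by_cases h : T.Adj u v <;> by_cases ha : a ∈ T.side u v <;> by_cases hb : b ∈ T.side u v <;>
      simp [h, ha, hb]
  rw [h3, h1, h2, ← Finset.sum_sub_distrib]
  refine Finset.sum_congr rfl fun T hT => ?_
  have hT := (mem_spanningTrees.1 hT).2
  by_cases h : T.Adj a b
  · simp only [h, h.symm, hT.mem_side_swap h, true_and]
    by_cases ha : u ∈ T.side a b <;> by_cases hb : v ∈ T.side a b <;> simp [ha, hb]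
  · have h' : ¬ T.Adj b a := fun h' => h h'.symm
    simp [h, h']

open Classical in
theorem IsTree.sum_notMem_side {T : SimpleGraph V} (hT : T.IsTree) (w y : V) :
    ∑ x, (if T.Adj w x ∧ y ∉ T.side w x then (1 : ℝ) else 0) = if y = w then 0 else 1 := by
  split_ifs with hy
  · subst hy
    simp [mem_side_self]
  · obtain ⟨x, hx, hx'⟩ := hT.existsUnique_adj_notMem_side hy
    rw [Finset.sum_eq_single x (fun z _ hz => if_neg fun h => hz (hx' z h)) (by simp), if_pos hx]

open Classical in
/-- The potential of `uv` is harmonic away from `u` and `v`: summed over the neighbours of `w`, each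
spanning tree contributes the net flow out of `w` of its path from `u` to `v`. -/
theorem sum_treePotential_sub (G : SimpleGraph V) [DecidableRel G.Adj] {u v : V}
    (huv : G.Adj u v) (w : V) :
    ∑ x, (if G.Adj w x then G.treePotential u v w - G.treePotential u v x else 0) =
      #G.spanningTrees * ((if u = w then 1 else 0) - if v = w then 1 else 0) := by
  have h : ∀ x, (if G.Adj w x then G.treePotential u v w - G.treePotential u v x else 0) =
      ∑ T ∈ G.spanningTrees, ((if T.Adj w x ∧ v ∉ T.side w x then (1 : ℝ) else 0) -
        if T.Adj w x ∧ u ∉ T.side w x then 1 else 0) := by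
    intro x
    split_ifs with hx
    · exact G.treePotential_sub huv hx
    · refine (Finset.sum_eq_zero fun T hT => ?_).symm
      have : ¬ T.Adj w x := fun h => hx ((mem_spanningTrees.1 hT).1 h)
      simp [this]
  rw [Finset.sum_congr rfl fun x _ => h x, Finset.sum_comm, ← nsmul_eq_mul, ← Finset.sum_const]
  refine Finset.sum_congr rfl fun T hT => ?_
  have hT := (mem_spanningTrees.1 hT).2
  rw [Finset.sum_sub_distrib, hT.sum_notMem_side, hT.sum_notMem_side]
  split_ifs <;> norm_num

/-- The Dirichlet form of `G`: the sum over the edges `xy` of `(f x - f y) * (g x - g y)`, written as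
half of the sum over the ordered pairs of adjacent vertices. -/
noncomputable def dirichlet (G : SimpleGraph V) [DecidableRel G.Adj] (f g : V → ℝ) : ℝ :=
  (∑ x, ∑ y, if G.Adj x y then (f x - f y) * (g x - g y) else 0) / 2

section Dirichlet

variable (G : SimpleGraph V) [DecidableRel G.Adj]

theorem dirichlet_comm (f g : V → ℝ) : G.dirichlet f g = G.dirichlet g f := by
  simp only [dirichlet, mul_comm]

theorem dirichlet_add_left (f f' g : V → ℝ) :
    G.dirichlet (f + f') g = G.dirichlet f g + G.dirichlet f' g := by
  rw [dirichlet, dirichlet, dirichlet, ← add_div]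
  simp only [← Finset.sum_add_distrib, Pi.add_apply]
  refine congrArg (· / 2) (Finset.sum_congr rfl fun x _ => Finset.sum_congr rfl fun y _ => ?_)
  split_ifs <;> ring

theorem dirichlet_smul_left (c : ℝ) (f g : V → ℝ) :
    G.dirichlet (c • f) g = c * G.dirichlet f g := by
  rw [dirichlet, dirichlet, mul_div_assoc', Finset.mul_sum]
  simp only [Finset.mul_sum, Pi.smul_apply, smul_eq_mul]
  refine congrArg (· / 2) (Finset.sum_congr rfl fun x _ => Finset.sum_congr rfl fun y _ => ?_)
  split_ifs <;> ring

theorem dirichlet_self_nonneg (f : V → ℝ) : 0 ≤ G.dirichlet f f := by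
  refine div_nonneg (Finset.sum_nonneg fun x _ => Finset.sum_nonneg fun y _ => ?_) two_pos.le
  split_ifs
  exacts [mul_self_nonneg _, le_rfl]

/-- Cauchy–Schwarz for the Dirichlet form. -/
theorem sq_dirichlet_le (f g : V → ℝ) :
    G.dirichlet f g ^ 2 ≤ G.dirichlet f f * G.dirichlet g g := by
  have h : ∀ t : ℝ, 0 ≤ G.dirichlet f f * (t * t) + (2 * G.dirichlet f g) * t +
      G.dirichlet g g := by
    intro t
    have := G.dirichlet_self_nonneg (t • f + g)
    rw [dirichlet_add_left, dirichlet_smul_left, G.dirichlet_comm f, G.dirichlet_comm g,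
      dirichlet_add_left, dirichlet_add_left, dirichlet_smul_left, dirichlet_smul_left,
      G.dirichlet_comm g f] at this
    linarith
  have := discrim_le_zero h
  rw [discrim] at this
  linarith

/-- Summation by parts. -/
theorem dirichlet_eq_sum (f g : V → ℝ) :
    G.dirichlet f g = ∑ x, f x * ∑ y, if G.Adj x y then g x - g y else 0 := by
  have h1 : ∑ x, ∑ y, (if G.Adj x y then (f x - f y) * (g x - g y) else 0) =
      (∑ x, ∑ y, if G.Adj x y then f x * (g x - g y) else 0) +
      ∑ x, ∑ y, if G.Adj x y then f y * (g y - g x) else 0 := by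
    simp only [← Finset.sum_add_distrib]
    refine Finset.sum_congr rfl fun x _ => Finset.sum_congr rfl fun y _ => ?_
    split_ifs <;> ring
  have h2 : ∑ x, ∑ y, (if G.Adj x y then f y * (g y - g x) else 0) =
      ∑ x, ∑ y, if G.Adj x y then f x * (g x - g y) else 0 := by
    rw [Finset.sum_comm]
    simp only [G.adj_comm]
  rw [dirichlet, h1, h2]
  simp only [Finset.mul_sum, mul_ite, mul_zero]
  ring

end Dirichlet

open Classical in
/-- The Dirichlet principle for an edge `uv`: a function that drops by one along `uv` has energy at
least the effective conductance between `u` and `v`, which is the ratio of the number of all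
spanning trees to the number of those through `uv`. -/
theorem card_spanningTrees_le_dirichlet (G : SimpleGraph V) [DecidableRel G.Adj] {u v : V}
    (huv : G.Adj u v) {f : V → ℝ} (hf : f u - f v = 1) :
    (#G.spanningTrees : ℝ) ≤ G.dirichlet f f * #{T ∈ G.spanningTrees | T.Adj u v} := by
  have hL : ∀ g : V → ℝ, G.dirichlet g (G.treePotential u v) = #G.spanningTrees * (g u - g v) := by
    intro g
    have : ∀ x, g x * (∑ y, if G.Adj x y then G.treePotential u v x - G.treePotential u v y else 0)
        = (if u = x then #G.spanningTrees * g x else 0) -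
          (if v = x then #G.spanningTrees * g x else 0) := by
      intro x
      rw [G.sum_treePotential_sub huv x]
      split_ifs <;> ring
    rw [dirichlet_eq_sum, Finset.sum_congr rfl fun x _ => this x, Finset.sum_sub_distrib,
      Finset.sum_ite_eq, Finset.sum_ite_eq]
    simp [mul_sub]
  have hu : G.treePotential u v u = #{T ∈ G.spanningTrees | T.Adj u v} := by
    rw [Finset.natCast_card_filter, treePotential]
    simp [mem_side_self]
  have hv : G.treePotential u v v = 0 := by
    refine Finset.sum_eq_zero fun T hT => if_neg fun h => ?_
    exact (mem_spanningTrees.1 hT).2.notMem_side h.1 h.2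
  have h := G.sq_dirichlet_le f (G.treePotential u v)
  rw [hL, hL, hf, hu, hv, sub_zero, mul_one] at h
  rcases (Nat.cast_nonneg (α := ℝ) #G.spanningTrees).eq_or_lt with h0 | h0
  · rw [← h0]
    exact mul_nonneg (G.dirichlet_self_nonneg f) (Nat.cast_nonneg _)
  · refine le_of_mul_le_mul_left ?_ h0
    linarith

end Finite

section Finite

variable {V : Type*} [Fintype V]

open Finset

/-! ### Energies in regular equiarboreal graphs -/

open Classical in
/-- Counting the pairs of a spanning tree and an edge of it in two ways. -/
theorem sum_card_spanningTrees_edge (G : SimpleGraph V) [Fintype G.edgeSet] :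
    ∑ e ∈ G.edgeFinset, #{T ∈ G.spanningTrees | e ∈ T.edgeSet} =
      #G.spanningTrees * (Fintype.card V - 1) := by
  simp only [card_filter]
  rw [sum_comm, ← smul_eq_mul, ← sum_const]
  refine sum_congr rfl fun T hT => ?_
  obtain ⟨hle, hT⟩ := mem_spanningTrees.1 hT
  have h1 := hT.card_edgeFinset
  rw [← card_filter, ← h1, Nat.add_sub_cancel]
  congr 1
  ext e
  simp only [mem_filter, mem_edgeFinset]
  exact ⟨fun h => h.2, fun h => ⟨edgeSet_mono hle h, h⟩⟩

/-- In a `k`-regular equiarboreal graph on `n` vertices every edge lies in a proportion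
`2 * (n - 1) / (n * k)` of the spanning trees, so the conductance along an edge exceeds `k / 2`. -/
theorem IsEquiarboreal.half_lt_dirichlet {G : SimpleGraph V} [DecidableRel G.Adj] {k : ℕ}
    (harb : G.IsEquiarboreal) (hconn : G.Connected) (hreg : G.IsRegularOfDegree k) {u v : V}
    (huv : G.Adj u v) {f : V → ℝ} (hf : f u - f v = 1) : (k : ℝ) / 2 < G.dirichlet f f := by
  classical
  set c := #{T ∈ G.spanningTrees | T.Adj u v} with hc
  have hcard : ∀ e ∈ G.edgeFinset, #{T ∈ G.spanningTrees | e ∈ T.edgeSet} = c := by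
    intro e he
    have hn : ∀ e : Sym2 V, {T : SimpleGraph V | T ≤ G ∧ T.IsTree ∧ e ∈ T.edgeSet}.ncard =
        #{T ∈ G.spanningTrees | e ∈ T.edgeSet} := by
      intro e
      rw [← Set.ncard_coe_finset]
      congr 1
      ext T
      simp [mem_spanningTrees, and_assoc]
    rw [← hn, harb e (mem_edgeFinset.1 he) s(u, v) huv, hn]
    simp only [mem_edgeSet, hc]
  have h1 := G.sum_card_spanningTrees_edge
  rw [sum_congr rfl hcard, sum_const, smul_eq_mul] at h1
  have h2 := G.sum_degrees_eq_twice_card_edges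
  simp only [hreg.degree_eq, sum_const, smul_eq_mul, card_univ] at h2
  have hV : 1 < Fintype.card V := Fintype.one_lt_card_iff.2 ⟨u, v, huv.ne⟩
  have hk : 0 < k := by
    rw [← hreg.degree_eq u]
    exact (G.degree_pos_iff_exists_adj u).2 ⟨v, huv⟩
  have hpos : 0 < #G.spanningTrees := by
    obtain ⟨T, hle, hT⟩ := hconn.exists_isTree_le
    exact card_pos.2 ⟨T, mem_spanningTrees.2 ⟨hle, hT⟩⟩
  have h3 := G.card_spanningTrees_le_dirichlet huv hf
  obtain ⟨n, hn⟩ : ∃ n, Fintype.card V = n + 1 := ⟨Fintype.card V - 1, by omega⟩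
  rw [hn] at h1 h2
  rw [Nat.add_sub_cancel] at h1
  have hn0 : 0 < n := by omega
  have h1' : (#G.edgeFinset : ℝ) * c = #G.spanningTrees * n := by exact_mod_cast h1
  have h2' : ((n : ℝ) + 1) * k = 2 * #G.edgeFinset := by exact_mod_cast h2
  have hn' : (0 : ℝ) < n := by exact_mod_cast hn0
  have hk' : (0 : ℝ) < k := by exact_mod_cast hk
  have hp' : (0 : ℝ) < #G.spanningTrees := by exact_mod_cast hpos
  have h3' : (#G.spanningTrees : ℝ) ≤ G.dirichlet f f * c := by convert! h3
  have h4 : (#G.edgeFinset : ℝ) ≤ G.dirichlet f f * n := by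
    refine le_of_mul_le_mul_left ?_ hp'
    calc (#G.spanningTrees : ℝ) * #G.edgeFinset
        ≤ (G.dirichlet f f * c) * #G.edgeFinset :=
          mul_le_mul_of_nonneg_right h3' (Nat.cast_nonneg _)
      _ = #G.spanningTrees * (G.dirichlet f f * n) := by
          linear_combination G.dirichlet f f * h1'
  refine lt_of_mul_lt_mul_right ?_ hn'.le
  linarith

end Finite

/-! ### Edge cuts -/

section EdgesAcross

variable {V : Type*}

theorem edgesAcross_compl (G : SimpleGraph V) (A : Set V) :
    G.edgesAcross Aᶜ = G.edgesAcross A := by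
  ext e
  constructor
  · rintro ⟨u, hu, v, hv, h, rfl⟩
    exact ⟨v, not_not.1 hv, u, hu, h.symm, Sym2.eq_swap⟩
  · rintro ⟨u, hu, v, hv, h, rfl⟩
    exact ⟨v, hv, u, not_not.2 hu, h.symm, Sym2.eq_swap⟩

theorem mk_mem_edgesAcross {G : SimpleGraph V} {A : Set V} {x y : V} :
    s(x, y) ∈ G.edgesAcross A ↔ G.Adj x y ∧ (x ∈ A ↔ y ∉ A) := by
  constructor
  · rintro ⟨u, hu, v, hv, h, he⟩
    rcases Sym2.eq_iff.1 he with ⟨rfl, rfl⟩ | ⟨rfl, rfl⟩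
    · exact ⟨h, by simpa [hu] using hv⟩
    · exact ⟨h.symm, by simpa [hu] using hv⟩
  · rintro ⟨h, hxy⟩
    by_cases hx : x ∈ A
    · exact ⟨x, hx, y, hxy.1 hx, h, rfl⟩
    · exact ⟨y, by tauto, x, hx, h.symm, Sym2.eq_swap⟩

end EdgesAcross

section Finite

variable {V : Type*} [Fintype V]

open Finset

open Classical in
/-- The number of edges at `x` with exactly one end in `A`, that is, the degree of `x` in the
subgraph formed by the edges of the cut `(A, Aᶜ)`. -/
noncomputable def cutDegree (G : SimpleGraph V) (A : Set V) (x : V) : ℕ :=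
  #{y | G.Adj x y ∧ (x ∈ A ↔ y ∉ A)}

theorem ncard_neighborSet_edgeInduced (G : SimpleGraph V) (A : Set V) (x : V) :
    ((G.edgeInduced (G.edgesAcross A)).neighborSet x).ncard = G.cutDegree A x := by
  rw [cutDegree, ← Set.ncard_coe_finset]
  congr 1
  ext y
  rw [coe_filter, Subgraph.mem_neighborSet]
  change G.Adj x y ∧ s(x, y) ∈ G.edgesAcross A ↔ _
  rw [mk_mem_edgesAcross]
  simp

open Classical in
theorem ncard_edgesAcross (G : SimpleGraph V) (A : Set V) :
    (G.edgesAcross A).ncard = ∑ x with x ∈ A, G.cutDegree A x := by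
  have h : G.edgesAcross A = (fun p : (_ : V) × V => s(p.1, p.2)) ''
      ((univ.filter (· ∈ A)).sigma fun x => univ.filter fun y => G.Adj x y ∧ (x ∈ A ↔ y ∉ A)) := by
    ext e
    constructor
    · rintro ⟨u, hu, v, hv, h, rfl⟩
      refine ⟨⟨u, v⟩, ?_, rfl⟩
      have hv : v ∉ A := hv
      simp [hu, hv, h]
    · rintro ⟨⟨x, y⟩, hp, rfl⟩
      simp only [coe_sigma, Set.mem_sigma_iff, coe_filter, Set.mem_ofPred_eq, mem_univ,
        true_and] at hp
      exact mk_mem_edgesAcross.2 hp.2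
  rw [h, Set.InjOn.ncard_image, Set.ncard_coe_finset, card_sigma]
  · rfl
  · rintro ⟨x, y⟩ hp ⟨x', y'⟩ hp' he
    simp only [coe_sigma, Set.mem_sigma_iff, coe_filter, Set.mem_ofPred_eq, mem_univ,
      true_and] at hp hp'
    rcases Sym2.eq_iff.1 he with ⟨h, h'⟩ | ⟨h, h'⟩
    · simp only at h h'
      subst h; subst h'; rfl
    · simp only at h h'
      subst h; subst h'
      exact absurd hp'.1 (hp.2.2.1 hp.1)

section Indicator

variable (G : SimpleGraph V) [DecidableRel G.Adj]

theorem sum_indicator_sub_of_mem {A : Set V} {x : V} (hx : x ∈ A) :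
    ∑ y, (if G.Adj x y then A.indicator (1 : V → ℝ) x - A.indicator 1 y else 0) =
      G.cutDegree A x := by
  classical
  rw [cutDegree, natCast_card_filter]
  refine sum_congr rfl fun y _ => ?_
  by_cases hy : y ∈ A <;> simp [hx, hy]

theorem sum_indicator_sub_of_notMem {A : Set V} {x : V} (hx : x ∉ A) :
    ∑ y, (if G.Adj x y then A.indicator (1 : V → ℝ) x - A.indicator 1 y else 0) =
      -G.cutDegree A x := by
  classical
  rw [cutDegree, natCast_card_filter, ← sum_neg_distrib]
  refine sum_congr rfl fun y _ => ?_
  by_cases hy : y ∈ A <;> by_cases h : G.Adj x y <;> simp [hx, hy, h]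

theorem dirichlet_indicator_self (A : Set V) :
    G.dirichlet (A.indicator 1) (A.indicator 1) = (G.edgesAcross A).ncard := by
  classical
  rw [dirichlet_eq_sum, ncard_edgesAcross, Nat.cast_sum, sum_filter]
  refine sum_congr rfl fun x _ => ?_
  split_ifs with hx
  · rw [G.sum_indicator_sub_of_mem hx]
    simp [hx]
  · simp [hx]

variable [DecidableEq V]

theorem dirichlet_single_left (g : V → ℝ) (u : V) :
    G.dirichlet (Pi.single u 1) g = ∑ y, if G.Adj u y then g u - g y else 0 := by
  rw [dirichlet_eq_sum, sum_eq_single u]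
  · simp
  · intro x _ hx
    simp [hx]
  · simp

theorem dirichlet_single_single {u v : V} (h : G.Adj u v) :
    G.dirichlet (Pi.single u 1) (Pi.single v 1) = -1 := by
  rw [dirichlet_single_left, sum_eq_single v]
  · simp [h, h.ne]
  · intro x _ hx
    simp [hx, h.ne]
  · simp

theorem dirichlet_single_self (u : V) :
    G.dirichlet (Pi.single u 1) (Pi.single u 1) = G.degree u := by
  rw [dirichlet_single_left, ← card_neighborFinset_eq_degree, neighborFinset_eq_filter,
    natCast_card_filter]
  refine sum_congr rfl fun x _ => ?_
  split_ifs with h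
  · simp [h.ne']
  · rfl

/-- The energy of a linear combination of the indicators of a set and of two adjacent vertices. -/
theorem dirichlet_indicator_add_single {k : ℕ} (hreg : G.IsRegularOfDegree k) (A : Set V) {u v : V}
    (huv : G.Adj u v) (α β γ : ℝ) :
    G.dirichlet (α • A.indicator 1 + (β • Pi.single u 1 + γ • Pi.single v 1))
        (α • A.indicator 1 + (β • Pi.single u 1 + γ • Pi.single v 1)) =
      α ^ 2 * (G.edgesAcross A).ncard + (β ^ 2 + γ ^ 2) * k
        + 2 * α * β * G.dirichlet (Pi.single u 1) (A.indicator 1)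
        + 2 * α * γ * G.dirichlet (Pi.single v 1) (A.indicator 1) - 2 * β * γ := by
  have hr : ∀ (c : ℝ) (f g : V → ℝ), G.dirichlet f (c • g) = c * G.dirichlet f g := fun c f g => by
    rw [dirichlet_comm, dirichlet_smul_left, dirichlet_comm]
  have ha : ∀ f g g' : V → ℝ, G.dirichlet f (g + g') = G.dirichlet f g + G.dirichlet f g' :=
    fun f g g' => by rw [dirichlet_comm, dirichlet_add_left, dirichlet_comm, G.dirichlet_comm g']
  simp only [dirichlet_add_left, dirichlet_smul_left, hr, ha, dirichlet_indicator_self,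
    dirichlet_single_self, hreg.degree_eq, G.dirichlet_single_single huv,
    G.dirichlet_single_single huv.symm, G.dirichlet_comm (A.indicator 1)]
  ring

end Indicator

theorem cutDegree_le_ncard (G : SimpleGraph V) {A : Set V} {x : V} (hx : x ∈ A) :
    G.cutDegree A x ≤ (G.edgesAcross A).ncard := by
  classical
  rw [ncard_edgesAcross]
  exact single_le_sum (f := G.cutDegree A) (fun _ _ => Nat.zero_le _) (by simp [hx])

open Classical in
/-- The neighbours of `u` that lie in `A`. -/
noncomputable def neighborsIn (G : SimpleGraph V) (A : Set V) (u : V) : Finset V :=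
  {y | G.Adj u y ∧ y ∈ A}

theorem mem_neighborsIn {G : SimpleGraph V} {A : Set V} {u y : V} :
    y ∈ G.neighborsIn A u ↔ G.Adj u y ∧ y ∈ A := by
  simp [neighborsIn]

theorem cutDegree_add_card (G : SimpleGraph V) [DecidableRel G.Adj] {A : Set V} {x : V}
    (hx : x ∈ A) : G.cutDegree A x + #(G.neighborsIn A x) = G.degree x := by
  classical
  rw [← card_neighborFinset_eq_degree, neighborFinset_eq_filter,
    ← card_filter_add_card_filter_not (s := univ.filter (G.Adj x)) (fun y => y ∉ A),
    filter_filter, filter_filter, cutDegree, neighborsIn]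
  simp [hx]
  congr!

/-- If `u ∈ A` has a neighbour in `A`, then it has such a neighbour `w` whose number of cut edges is
at most the average, over these neighbours, of the number of cut edges that are not at `u`. -/
theorem exists_adj_card_mul_cutDegree_le (G : SimpleGraph V) {A : Set V} {u : V} (hu : u ∈ A)
    (hne : (G.neighborsIn A u).Nonempty) :
    ∃ w ∈ A, G.Adj u w ∧ #(G.neighborsIn A u) * G.cutDegree A w + G.cutDegree A u ≤
      (G.edgesAcross A).ncard := by
  classical
  obtain ⟨w, hw, hmin⟩ := exists_min_image _ (G.cutDegree A) hne
  have hw' := mem_neighborsIn.1 hw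
  refine ⟨w, hw'.2, hw'.1, ?_⟩
  have h1 : #(G.neighborsIn A u) * G.cutDegree A w ≤
      ∑ x ∈ G.neighborsIn A u, G.cutDegree A x := card_nsmul_le_sum _ _ _ hmin
  have h2 : u ∉ G.neighborsIn A u := by simp [mem_neighborsIn]
  have h3 : ∑ x ∈ insert u (G.neighborsIn A u), G.cutDegree A x ≤
      ∑ x with x ∈ A, G.cutDegree A x := by
    refine sum_le_sum_of_subset fun x hx => ?_
    rcases mem_insert.1 hx with rfl | hx
    · simp [hu]
    · simp [(mem_neighborsIn.1 hx).2]
  rw [sum_insert h2, ← ncard_edgesAcross] at h3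
  omega

/-! ### Vertices of degree one in a small cut -/

/-- A vertex `v ∉ A` of degree one in a small cut `(A, Aᶜ)` leads to a function of energy at most
`k / 2` that drops by one along an edge. -/
theorem IsEquiarboreal.cutDegree_ne_one {G : SimpleGraph V} [DecidableRel G.Adj] {k : ℕ}
    (harb : G.IsEquiarboreal) (hconn : G.Connected) (hreg : G.IsRegularOfDegree k) {A : Set V}
    (h : (6 ≤ k ∧ (G.edgesAcross A).ncard ≤ k - 1) ∨
      (8 ≤ k ∧ A.Nontrivial ∧ (G.edgesAcross A).ncard ≤ k))
    {u v : V} (hu : u ∈ A) (hv : v ∉ A) (huv : G.Adj u v) : G.cutDegree A v ≠ 1 := by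
  classical
  intro hv1
  set c := (G.edgesAcross A).ncard with hc
  set d := G.cutDegree A u with hd
  have hdc : d ≤ c := G.cutDegree_le_ncard hu
  have hdk := G.cutDegree_add_card hu
  rw [hreg.degree_eq, ← hd] at hdk
  set a := #(G.neighborsIn A u) with ha
  have hDu : G.dirichlet (Pi.single u 1) (A.indicator 1) = d := by
    rw [dirichlet_single_left, G.sum_indicator_sub_of_mem hu]
  have hDv : G.dirichlet (Pi.single v 1) (A.indicator 1) = -1 := by
    rw [dirichlet_single_left, G.sum_indicator_sub_of_notMem hv, hv1, Nat.cast_one]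
  rcases lt_or_ge a 3 with ha3 | ha3
  · -- `u` has at most two neighbours in `A`: move `u` to the other part of the cut
    obtain ⟨w, hwA, hwu⟩ : ∃ w ∈ A, w ≠ u := by
      rcases h with h | h
      · have : 0 < a := by omega
        obtain ⟨w, hw⟩ := card_pos.1 this
        have := mem_neighborsIn.1 hw
        exact ⟨w, this.2, this.1.ne'⟩
      · exact h.2.1.exists_ne u
    obtain ⟨p⟩ := hconn.preconnected w u
    obtain ⟨e, -, he1, he2⟩ := p.exists_boundary_dart (A \ {u}) ⟨hwA, hwu⟩ (by simp)
    have hE := harb.half_lt_dirichlet hconn hreg e.adj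
      (f := (1 : ℝ) • A.indicator 1 + ((-1 : ℝ) • Pi.single u 1 + (0 : ℝ) • Pi.single v 1)) (by
        have h1 : e.fst ≠ u := he1.2
        by_cases h2 : e.snd = u
        · simp [he1.1, h1, h2, hu]
        · have h3 : e.snd ∉ A := fun h3 => he2 ⟨h3, h2⟩
          simp [he1.1, h1, h2, h3])
    rw [G.dirichlet_indicator_add_single hreg A huv, hDu, hDv, ← hc] at hE
    have hE' : k + 4 * d < 2 * c + 2 * k := by
      have : (k : ℝ) + 4 * d < 2 * c + 2 * k := by linarith
      exact_mod_cast this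
    omega
  · rcases ha3.eq_or_lt with ha3 | ha3
    · -- `u` has three neighbours in `A`, and a test function for the cut `(A \ {u}, Aᶜ ∪ {u})`
      -- serves for the edge from one of them to `u`
      obtain ⟨w, hwA, huw, hw⟩ := G.exists_adj_card_mul_cutDegree_le hu (card_pos.1 (by omega))
      rw [← ha, ← ha3, ← hc, ← hd] at hw
      have hDw : G.dirichlet (Pi.single w 1) (A.indicator 1) = G.cutDegree A w := by
        rw [dirichlet_single_left, G.sum_indicator_sub_of_mem hwA]
      have hE := harb.half_lt_dirichlet hconn hreg huw.symm
        (f := (1 / 3 : ℝ) • A.indicator 1 +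
          ((1 / 3 : ℝ) • Pi.single w 1 + (-2 / 3 : ℝ) • Pi.single u 1)) (by
          simp [hwA, hu, huw.ne, huw.ne']
          norm_num)
      rw [G.dirichlet_indicator_add_single hreg A huw.symm, hDu, hDw, ← hc] at hE
      have hE' : 9 * k + 8 * d < 2 * (c + 5 * k + 2 * G.cutDegree A w + 4) := by
        have : (9 : ℝ) * k + 8 * d < 2 * (c + 5 * k + 2 * G.cutDegree A w + 4) := by linarith
        exact_mod_cast this
      omega
    · -- the test function is `1`, `3 / 4`, `0`, `1 / 2` on `u`, `A \ {u}`, `v`, `Aᶜ \ {v}`,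
      -- up to a constant
      have hE := harb.half_lt_dirichlet hconn hreg huv
        (f := (1 / 4 : ℝ) • A.indicator 1 +
          ((1 / 4 : ℝ) • Pi.single u 1 + (-1 / 2 : ℝ) • Pi.single v 1)) (by
          simp [hu, hv, huv.ne, huv.ne']
          norm_num)
      rw [G.dirichlet_indicator_add_single hreg A huv, hDu, hDv, ← hc] at hE
      have hE' : 8 * k < c + 5 * k + 2 * d + 8 := by
        have : (8 : ℝ) * k < c + 5 * k + 2 * d + 8 := by linarith
        exact_mod_cast this
      omega

/-- No vertex has degree one in the subgraph formed by a small cut: by the symmetry between the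
parts of the cut it does not matter on which side it lies. -/
theorem IsEquiarboreal.ncard_neighborSet_edgeInduced_ne_one {G : SimpleGraph V} [DecidableRel G.Adj]
    {k : ℕ} (harb : G.IsEquiarboreal) (hconn : G.Connected) (hreg : G.IsRegularOfDegree k)
    {A : Set V}
    (h : (6 ≤ k ∧ (G.edgesAcross A).ncard ≤ k - 1) ∨
      (8 ≤ k ∧ A.Nontrivial ∧ Aᶜ.Nontrivial ∧ (G.edgesAcross A).ncard ≤ k)) (v : V) :
    ((G.edgeInduced (G.edgesAcross A)).neighborSet v).ncard ≠ 1 := by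
  intro hv
  obtain ⟨u, hu⟩ := Set.nonempty_of_ncard_ne_zero (by rw [hv]; exact one_ne_zero)
  obtain ⟨hvu, hA⟩ := mk_mem_edgesAcross.1 (show s(v, u) ∈ G.edgesAcross A from hu.2)
  by_cases hvA : v ∈ A
  · rw [← edgesAcross_compl, ncard_neighborSet_edgeInduced] at hv
    refine harb.cutDegree_ne_one hconn hreg ?_ (hA.1 hvA) (not_not.2 hvA) hvu.symm hv
    rw [edgesAcross_compl]
    exact h.imp id fun h => ⟨h.1, h.2.2.1, h.2.2.2⟩
  · rw [ncard_neighborSet_edgeInduced] at hv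
    exact harb.cutDegree_ne_one hconn hreg (h.imp id fun h => ⟨h.1, h.2.1, h.2.2.2⟩)
      (by tauto) hvA hvu.symm hv

end Finite

end SimpleGraph

theorem theorem3p8 {V : Type*} [Fintype V] (G : SimpleGraph V) [DecidableRel G.Adj] (k : ℕ)
    (hconn : G.Connected) (hreg : G.IsRegularOfDegree k) (harb : G.IsEquiarboreal)
    (C : Set (Sym2 V)) (hC : G.IsEdgeCut C) :
    (6 ≤ k → C.ncard ≤ k - 1 →
      ∀ x : ℕ, 3 ≤ x → (G.edgeInduced C).IsStronglyStarFree x) ∧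
    (8 ≤ k → G.IsNontrivialEdgeCut C → C.ncard ≤ k →
      ∀ x : ℕ, 3 ≤ x → (G.edgeInduced C).IsStronglyStarFree x) := by
  constructor
  · rintro hk hle x - ⟨u, -, φ, i, -, hi⟩
    obtain ⟨A, -, -, rfl⟩ := hC
    exact harb.ncard_neighborSet_edgeInduced_ne_one hconn hreg (Or.inl ⟨hk, hle⟩) _ hi
  · rintro hk ⟨A, hA, hA', rfl⟩ hle x - ⟨u, -, φ, i, -, hi⟩
    exact harb.ncard_neighborSet_edgeInduced_ne_one hconn hreg (Or.inr ⟨hk, hA, hA', hle⟩) _ hi
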